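/- Tableaux are drawn in English notation. A skew tableau is a filling of a skew shape $\lambda/\mu$ with positive integers whose rows weakly increase from left to right and whose columns strictly increase from top to bottom; it is standard if it uses each of $1,\dots,m$ exactly once, where $m=|S|$ is its number of cells. An inner slide (jeu de taquin) on a skew tableau slides entries into an outer corner of the inner shape, and on into the hole so created, always keeping rows and columns increasing, until the hole reaches an outer corner of the outer shape. $\operatorname{Rect}(S)$ is the tableau of straight shape obtained by performing inner slides, in any order, until the inner shape is empty. Let $S$ be a standard skew tableau with $m$ cells whose row sizes weakly decrease from top to bottom. For $k\ge 1$ let $S^{(k)}$ be the standard skew tableau obtained by attaching to the right of $S$, row by row, its shifted copies $S+m,\ S+2m,\ \dots,\ S+(k-1)m$ (all entries increased by $m, 2m, \dots$). We say that $S$ *stabilizes at* $k\ge 1$ if every entry in $[(k-1)m+1,\,km]$ lies in the same row in $\operatorname{Rect}(S^{(k)})$ as in $S^{(k)}$. **Theorem.** Let $b\ge 2$ and let $S$ be a standard skew tableau with $b$ rows, whose row sizes weakly decrease from top to bottom; here some of the lowest rows may be empty, so it is only required that all cells of $S$ lie in its first $b$ rows. Then $S$ stabilizes at $2b-2$. In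 particular, every such $S$ with $b=2$ rows stabilizes at $2=b$. -/

import Mathlib

/-- A (semistandard) skew tableau, in English notation: rows are numbered from top to bottom and
columns from left to right, starting at `0`.  The skew shape is `outer / inner`, the entries are
positive integers, rows increase weakly and columns increase strictly.  Outside the skew shape
`entry` is `0` by convention. -/
structure SkewTableau where
  /-- The outer partition. -/
  outer : YoungDiagram
  /-- The inner partition. -/
  inner : YoungDiagram
  inner_le : inner ≤ outer
  /-- The filling: `entry (i, j)` is the entry in row `i` and column `j`. -/
  entry : ℕ × ℕ → ℕ
  pos : ∀ c, c ∈ outer → c ∉ inner → 0 < entry c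
  zero : ∀ c, ¬ (c ∈ outer ∧ c ∉ inner) → entry c = 0
  row_weak : ∀ i j₁ j₂, j₁ < j₂ → (i, j₁) ∉ inner → (i, j₂) ∈ outer →
    entry (i, j₁) ≤ entry (i, j₂)
  col_strict : ∀ i₁ i₂ j, i₁ < i₂ → (i₁, j) ∉ inner → (i₂, j) ∈ outer →
    entry (i₁, j) < entry (i₂, j)

namespace SkewTableau

/-- The cells of the skew shape. -/
def cells (S : SkewTableau) : Finset (ℕ × ℕ) := S.outer.cells \ S.inner.cells

/-- The number of cells of `S`. -/
def size (S : SkewTableau) : ℕ := S.cells.card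

/-- The row vector of `S`: the number of cells in row `i`. -/
def rowSize (S : SkewTableau) (i : ℕ) : ℕ := (S.cells.filter fun c => c.1 = i).card

/-- `S` is standard if it uses each of `1, …, |S|` exactly once. -/
def IsStandard (S : SkewTableau) : Prop :=
  Set.BijOn S.entry (S.cells : Set (ℕ × ℕ)) (Set.Icc 1 S.size)

/-- The entry `x` occurs in row `i` of `S`. -/
def InRow (S : SkewTableau) (x i : ℕ) : Prop := ∃ j, (i, j) ∈ S.cells ∧ S.entry (i, j) = x

/-- One move of a jeu de taquin slide.  A state is a filling of the cells of `outer` together with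
the position of the hole.  Of the right and lower neighbours of the hole the smaller entry
(the lower one in case of a tie) moves into the hole, and its old cell becomes the hole. -/
inductive HoleMove (outer : YoungDiagram) : (ℕ × ℕ → ℕ) × (ℕ × ℕ) → (ℕ × ℕ → ℕ) × (ℕ × ℕ) → Prop
  | right (f : ℕ × ℕ → ℕ) (i j : ℕ) (hr : (i, j + 1) ∈ outer)
      (hlt : (i + 1, j) ∈ outer → f (i, j + 1) < f (i + 1, j)) :
      HoleMove outer (f, (i, j))
        (Function.update (Function.update f (i, j) (f (i, j + 1))) (i, j + 1) 0, (i, j + 1))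
  | down (f : ℕ × ℕ → ℕ) (i j : ℕ) (hd : (i + 1, j) ∈ outer)
      (hle : (i, j + 1) ∈ outer → f (i + 1, j) ≤ f (i, j + 1)) :
      HoleMove outer (f, (i, j))
        (Function.update (Function.update f (i, j) (f (i + 1, j))) (i + 1, j) 0, (i + 1, j))

/-- `c` is an outer corner of the partition `μ`: a cell of `μ` with no cell of `μ` to its right or
below it. -/
def IsOuterCorner (μ : YoungDiagram) (c : ℕ × ℕ) : Prop :=
  c ∈ μ ∧ (c.1, c.2 + 1) ∉ μ ∧ (c.1 + 1, c.2) ∉ μ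

/-- `S'` results from `S` by one inner slide: the hole starts at an outer corner `c` of the inner
shape, moves until it reaches an outer corner `e` of the outer shape, and is then removed. -/
def InnerSlide (S S' : SkewTableau) : Prop :=
  ∃ c e : ℕ × ℕ, IsOuterCorner S.inner c ∧ IsOuterCorner S.outer e ∧
    Relation.ReflTransGen (HoleMove S.outer) (S.entry, c) (S'.entry, e) ∧
    S'.inner.cells = S.inner.cells.erase c ∧ S'.outer.cells = S.outer.cells.erase e

/-- `T` is obtained from `S` by performing inner slides, in some order, until straight shape is
achieved. -/
def IsRectification (S T : SkewTableau) : Prop :=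
  Relation.ReflTransGen InnerSlide S T ∧ T.inner = ⊥

theorem mem_cells {S : SkewTableau} {i j : ℕ} :
    (i, j) ∈ S.cells ↔ S.inner.rowLen i ≤ j ∧ j < S.outer.rowLen i := by
  rw [cells, Finset.mem_sdiff, YoungDiagram.mem_cells, YoungDiagram.mem_cells,
    YoungDiagram.mem_iff_lt_rowLen, YoungDiagram.mem_iff_lt_rowLen, not_lt, and_comm]

theorem inner_rowLen_le (S : SkewTableau) (i : ℕ) : S.inner.rowLen i ≤ S.outer.rowLen i := by
  by_contra h
  have h1 : (i, S.outer.rowLen i) ∈ S.inner := YoungDiagram.mem_iff_lt_rowLen.2 (by omega)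
  have h2 := YoungDiagram.mem_iff_lt_rowLen.1 (S.inner_le h1)
  omega

theorem inner_add_rowSize (S : SkewTableau) (i : ℕ) :
    S.inner.rowLen i + S.rowSize i = S.outer.rowLen i := by
  have h : (S.cells.filter fun c => c.1 = i) =
      (Finset.Ico (S.inner.rowLen i) (S.outer.rowLen i)).image fun j => (i, j) := by
    ext ⟨a, j⟩
    simp only [Finset.mem_filter, Finset.mem_image, Finset.mem_Ico, Prod.mk.injEq]
    constructor
    · rintro ⟨h, rfl⟩
      exact ⟨j, mem_cells.1 h, rfl, rfl⟩
    · rintro ⟨x, hx, rfl, rfl⟩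
      exact ⟨mem_cells.2 hx, rfl⟩
  have := S.inner_rowLen_le i
  rw [rowSize, h, Finset.card_image_of_injective _ (fun a b hab => (Prod.mk.inj hab).2),
    Nat.card_Ico]
  omega

/-- The outer shape of `S^(k)`: row `i` starts with the cells of the inner shape of `S`, followed by
`k` times as many cells as row `i` of `S` has. -/
def copiesOuter (S : SkewTableau) (hdec : Antitone S.rowSize) (k : ℕ) : YoungDiagram where
  cells := (Finset.range (S.outer.colLen 0) ×ˢ
    Finset.range (S.inner.rowLen 0 + k * S.rowSize 0)).filter
      fun c => c.2 < S.inner.rowLen c.1 + k * S.rowSize c.1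
  isLowerSet := by
    rintro ⟨i, j⟩ ⟨i', j'⟩ ⟨hi, hj⟩ h
    simp only [Finset.coe_filter, Finset.mem_product, Finset.mem_range, Set.mem_ofPred_eq] at *
    have h1 := S.inner.rowLen_anti _ _ hi
    have h2 := Nat.mul_le_mul_left k (hdec hi)
    omega

theorem mem_copiesOuter {S : SkewTableau} {hdec : Antitone S.rowSize} {k i j : ℕ} :
    (i, j) ∈ S.copiesOuter hdec k ↔ j < S.inner.rowLen i + k * S.rowSize i := by
  rw [← YoungDiagram.mem_cells]
  simp only [copiesOuter, Finset.mem_filter, Finset.mem_product, Finset.mem_range,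
    and_iff_right_iff_imp]
  intro h
  have h1 := S.inner.rowLen_anti _ _ (Nat.zero_le i)
  have h2 := Nat.mul_le_mul_left k (hdec (Nat.zero_le i))
  refine ⟨?_, by omega⟩
  have h3 := S.inner_add_rowSize i
  have h4 : 0 < S.outer.rowLen i := by
    by_contra h0
    have : S.rowSize i = 0 := by omega
    rw [this] at h
    omega
  exact YoungDiagram.mem_iff_lt_colLen.1 (YoungDiagram.mem_iff_lt_rowLen.2 h4)

/-- The entries of `S^(k)`: the cell at distance `t` from the start of row `i` lies in the copy
number `t / rowSize i` (counted from `0`), and is the cell number `t % rowSize i` of row `i` in that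
copy, which is shifted by `|S|` times the number of the copy. -/
def copiesEntry (S : SkewTableau) (k : ℕ) (c : ℕ × ℕ) : ℕ :=
  if S.inner.rowLen c.1 ≤ c.2 ∧ c.2 < S.inner.rowLen c.1 + k * S.rowSize c.1 then
    S.entry (c.1, S.inner.rowLen c.1 + (c.2 - S.inner.rowLen c.1) % S.rowSize c.1) +
      S.size * ((c.2 - S.inner.rowLen c.1) / S.rowSize c.1)
  else 0

theorem copies_aux {S : SkewTableau} {k i j : ℕ} (h1 : S.inner.rowLen i ≤ j)
    (h2 : j < S.inner.rowLen i + k * S.rowSize i) :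
    ∃ q u, j = S.inner.rowLen i + u + q * S.rowSize i ∧ (i, S.inner.rowLen i + u) ∈ S.cells ∧
      S.copiesEntry k (i, j) = S.entry (i, S.inner.rowLen i + u) + S.size * q ∧
      u < S.rowSize i := by
  have hr : 0 < S.rowSize i := by
    rcases Nat.eq_zero_or_pos (S.rowSize i) with h | h
    · rw [h] at h2
      omega
    · exact h
  have h4 := S.inner_add_rowSize i
  have h3 := Nat.mod_lt (j - S.inner.rowLen i) hr
  have h5 := Nat.mod_add_div (j - S.inner.rowLen i) (S.rowSize i)
  refine ⟨(j - S.inner.rowLen i) / S.rowSize i, (j - S.inner.rowLen i) % S.rowSize i, ?_,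
    mem_cells.2 ⟨by omega, by omega⟩, ?_, h3⟩
  · rw [Nat.mul_comm] at h5
    omega
  · simp only [copiesEntry]
    rw [if_pos ⟨h1, h2⟩]

theorem entry_mono {S : SkewTableau} {i j₁ j₂ : ℕ} (h : j₁ ≤ j₂) (h1 : (i, j₁) ∈ S.cells)
    (h2 : (i, j₂) ∈ S.cells) : S.entry (i, j₁) ≤ S.entry (i, j₂) := by
  rcases h.eq_or_lt with rfl | h
  · exact le_rfl
  · simp only [cells, Finset.mem_sdiff, YoungDiagram.mem_cells] at h1 h2
    exact S.row_weak _ _ _ h h1.2 h2.1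

/-- `S^(k)`: the standard skew tableau obtained from a standard skew tableau `S` with weakly
decreasing row sizes by attaching `k - 1` shifted copies of `S` to the right of `S`, row by row. -/
def copies (S : SkewTableau) (hS : S.IsStandard) (hdec : Antitone S.rowSize) (k : ℕ) :
    SkewTableau where
  outer := S.copiesOuter hdec k
  inner := S.inner
  inner_le := by
    rintro ⟨i, j⟩ h
    have := YoungDiagram.mem_iff_lt_rowLen.1 h
    exact mem_copiesOuter.2 (by omega)
  entry := S.copiesEntry k
  pos := by
    rintro ⟨i, j⟩ h1 h2
    rw [mem_copiesOuter] at h1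
    rw [YoungDiagram.mem_iff_lt_rowLen, not_lt] at h2
    obtain ⟨q, u, -, hu, he, -⟩ := copies_aux h2 h1
    have := (hS.mapsTo hu).1
    omega
  zero := by
    rintro ⟨i, j⟩ h
    rw [mem_copiesOuter, YoungDiagram.mem_iff_lt_rowLen, not_lt, and_comm] at h
    exact if_neg h
  row_weak := by
    intro i j₁ j₂ hj h1 h2
    rw [YoungDiagram.mem_iff_lt_rowLen, not_lt] at h1
    rw [mem_copiesOuter] at h2
    obtain ⟨q₁, u₁, e₁, m₁, v₁, l₁⟩ := copies_aux h1 (hj.trans h2)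
    obtain ⟨q₂, u₂, e₂, m₂, v₂, l₂⟩ := copies_aux (h1.trans hj.le) h2
    rw [v₁, v₂]
    have b₁ := (hS.mapsTo m₁).2
    have hq : q₁ ≤ q₂ := by
      by_contra hq
      have := Nat.mul_le_mul_right (S.rowSize i) (show q₂ + 1 ≤ q₁ by omega)
      rw [Nat.add_mul] at this
      omega
    rcases hq.eq_or_lt with rfl | hq
    · have := entry_mono (show S.inner.rowLen i + u₁ ≤ S.inner.rowLen i + u₂ by omega) m₁ m₂
      omega
    · have := Nat.mul_le_mul_left S.size (show q₁ + 1 ≤ q₂ by omega)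
      rw [Nat.mul_add] at this
      omega
  col_strict := by
    intro i₁ i₂ j hi h1 h2
    rw [YoungDiagram.mem_iff_lt_rowLen, not_lt] at h1
    rw [mem_copiesOuter] at h2
    have a₁ := S.inner.rowLen_anti _ _ hi.le
    have a₂ := hdec hi.le
    have a₃ := Nat.mul_le_mul_left k a₂
    have a₄ := S.outer.rowLen_anti _ _ hi.le
    obtain ⟨q₁, u₁, e₁, m₁, v₁, l₁⟩ := copies_aux (k := k) h1 (by omega)
    obtain ⟨q₂, u₂, e₂, m₂, v₂, l₂⟩ := copies_aux (a₁.trans h1) h2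
    rw [v₁, v₂]
    have b₁ := (hS.mapsTo m₁).2
    have b₂ := (hS.mapsTo m₂).1
    have hq : q₁ ≤ q₂ := by
      by_contra hq
      have c₁ := Nat.mul_le_mul_right (S.rowSize i₁) (show q₂ + 1 ≤ q₁ by omega)
      have c₂ := Nat.mul_le_mul_left q₂ a₂
      rw [Nat.add_mul] at c₁
      omega
    rcases hq.eq_or_lt with rfl | hq
    · have c₂ := Nat.mul_le_mul_left q₁ a₂
      have hm := mem_cells.1 m₂
      have hm₁ := mem_cells.1 m₁
      have hmid : (i₁, S.inner.rowLen i₂ + u₂) ∈ S.cells := mem_cells.2 ⟨by omega, by omega⟩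
      have d₁ := entry_mono (show S.inner.rowLen i₁ + u₁ ≤ S.inner.rowLen i₂ + u₂ by omega)
        m₁ hmid
      simp only [cells, Finset.mem_sdiff, YoungDiagram.mem_cells] at hmid m₂
      have d₂ := S.col_strict _ _ _ hi hmid.2 m₂.1
      omega
    · have := Nat.mul_le_mul_left S.size (show q₁ + 1 ≤ q₂ by omega)
      rw [Nat.mul_add] at this
      omega

/-- `S` stabilizes at the positive integer `k`: the entries in `[(k - 1)m + 1, km]`, where
`m = |S|`, lie in the same rows in `Rect (S^(k))` and in `S^(k)`.  The rectification exists, and the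
condition is required of the outcome of the slides in every possible order. -/
def StabilizesAt (S : SkewTableau) (hS : S.IsStandard) (hdec : Antitone S.rowSize) (k : ℕ) : Prop :=
  0 < k ∧ (∃ T, IsRectification (S.copies hS hdec k) T) ∧
    ∀ T, IsRectification (S.copies hS hdec k) T →
      ∀ x, (k - 1) * S.size + 1 ≤ x → x ≤ k * S.size →
        ∀ i, T.InRow x i ↔ (S.copies hS hdec k).InRow x i

end SkewTableau

/-!
A skew tableau with distinct entries is the same thing as its inner shape together with the lattice
path whose `i`-th coordinate at time `t` counts the entries at most `t` in row `i` (`rowPath`).  In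
these terms rectification is a composition of Pitman transforms.  The transform `pitman i` pushes
the path in direction `e i - e (i + 1)` by just as much as is needed to keep `p (i + 1) ≤ p i`; it
is the maximal power of the `i`-th crystal raising operator on words.

*Rectification.*  A horizontal move of the hole in a jeu de taquin slide does not change the path.
A vertical move takes an entry `x` from row `i + 1` to row `i`, and the shape of the tableau forces
`x` to be the first time at which `p i - p (i + 1)` attains its minimum, so that `pitman i p` is
unchanged (`HoleTableau.pitman_move_down`).  Pitman transforms are idempotent and satisfy the braid
relations (`pitman_braid`).  Hence their composition `longestPitman` along a reduced word of the
longest permutation absorbs every `pitman i` (`longestPitman_pitman`) and is invariant under slides.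
The path of a straight tableau is dominant, so it is fixed by `longestPitman`.  Therefore the path
of the rectification, for every order of the slides, is `longestPitman` of the path of the skew
tableau (`SkewTableau.rowPath_rectification`).

*Stabilization.*  An entry lies in the same row before and after rectification if the two paths make
the same step at that time.  The path of `S^(k)` is periodic, and since the row sizes decrease
weakly, `p i - p (i + 1)` does not decrease over a period.  Hence it attains no new minimum after
the first period, and `pitman i` changes the steps in the first period only.  In general, if two
coordinates have been disturbed in the first `q` periods only, then `pitman i` disturbs them in the
first `q + 1` periods at most (`Settled.pitman`).  For `b = n + 2` rows the reduced word used can be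
performed in `2 * n + 1 = 2 * b - 3` rounds of commuting transforms, so the last one of `2 * b - 2`
copies is left undisturbed (`Settled.longestPitman`).
-/

/-! ### Pitman transforms -/

/-- The running maximum of `0, -D 0, …, -D t`: how far `D` has fallen below `0` up to time `t`. -/
def excess (D : ℕ → ℤ) : ℕ → ℤ
  | 0 => max 0 (-D 0)
  | t + 1 => max (excess D t) (-D (t + 1))

theorem excess_nonneg (D : ℕ → ℤ) (t : ℕ) : 0 ≤ excess D t := by
  induction t with
  | zero => simp [excess]
  | succ t ih => simp [excess, ih]

theorem excess_mono (D : ℕ → ℤ) : Monotone (excess D) :=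
  monotone_nat_of_le_succ fun _ => le_max_left _ _

theorem neg_le_excess (D : ℕ → ℤ) (t : ℕ) : -D t ≤ excess D t := by
  cases t <;> simp [excess]

theorem excess_le {D : ℕ → ℤ} {t : ℕ} {a : ℤ} (h0 : 0 ≤ a) (h : ∀ s ≤ t, -D s ≤ a) :
    excess D t ≤ a := by
  induction t with
  | zero => exact max_le h0 (h 0 le_rfl)
  | succ t ih => exact max_le (ih fun s hs => h s (by omega)) (h _ le_rfl)

theorem excess_congr {D D' : ℕ → ℤ} {t : ℕ} (h : ∀ s ≤ t, D s = D' s) :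
    excess D t = excess D' t := by
  induction t with
  | zero => simp [excess, h 0 le_rfl]
  | succ t ih => simp only [excess, h _ le_rfl, ih fun s hs => h s (by omega)]

/-- The Pitman transform of a lattice path `p`, where `p j t` is the `j`-th coordinate at time `t`,
with respect to the simple root `e i - e (i + 1)`: it pushes the path up by just as much as is
needed for `p i - p (i + 1)` to stay nonnegative.  On the word of steps of the path it is the
maximal power of the crystal raising operator with index `i`. -/
def pitman (i : ℕ) (p : ℕ → ℕ → ℤ) : ℕ → ℕ → ℤ := fun j t =>
  if j = i then p i t + excess (fun s => p i s - p (i + 1) s) t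
  else if j = i + 1 then p (i + 1) t - excess (fun s => p i s - p (i + 1) s) t
  else p j t

theorem pitman_left (i : ℕ) (p : ℕ → ℕ → ℤ) (t : ℕ) :
    pitman i p i t = p i t + excess (fun s => p i s - p (i + 1) s) t := if_pos rfl

theorem pitman_right (i : ℕ) (p : ℕ → ℕ → ℤ) (t : ℕ) :
    pitman i p (i + 1) t = p (i + 1) t - excess (fun s => p i s - p (i + 1) s) t := by
  simp [pitman]

theorem pitman_of_ne {i j : ℕ} (h : j ≠ i) (h' : j ≠ i + 1) (p : ℕ → ℕ → ℤ) :
    pitman i p j = p j := by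
  funext t
  simp [pitman, h, h']

/-- A path that stays in the half space `p (i + 1) ≤ p i` is fixed. -/
theorem pitman_eq_self {i : ℕ} {p : ℕ → ℕ → ℤ} (h : ∀ t, p (i + 1) t ≤ p i t) :
    pitman i p = p := by
  have h0 (t : ℕ) : excess (fun s => p i s - p (i + 1) s) t = 0 :=
    le_antisymm (excess_le le_rfl fun s _ => by linarith [h s]) (excess_nonneg _ _)
  funext j t
  simp only [pitman, h0]
  split_ifs <;> simp_all

theorem pitman_idem (i : ℕ) (p : ℕ → ℕ → ℤ) : pitman i (pitman i p) = pitman i p := by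
  refine pitman_eq_self fun t => ?_
  rw [pitman_left, pitman_right]
  have h1 := neg_le_excess (fun s => p i s - p (i + 1) s) t
  have h2 := excess_nonneg (fun s => p i s - p (i + 1) s) t
  omega

theorem pitman_comm {i j : ℕ} (h : i + 2 ≤ j) (p : ℕ → ℕ → ℤ) :
    pitman i (pitman j p) = pitman j (pitman i p) := by
  have e1 : pitman j p i = p i := pitman_of_ne (by omega) (by omega) p
  have e2 : pitman j p (i + 1) = p (i + 1) := pitman_of_ne (by omega) (by omega) p
  have e3 : pitman i p j = p j := pitman_of_ne (by omega) (by omega) p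
  have e4 : pitman i p (j + 1) = p (j + 1) := pitman_of_ne (by omega) (by omega) p
  funext l t
  by_cases h1 : l = i
  · subst h1
    rw [pitman_left, e1, e2, pitman_of_ne (i := j) (by omega) (by omega), pitman_left]
  by_cases h2 : l = i + 1
  · subst h2
    rw [pitman_right, e1, e2, pitman_of_ne (i := j) (by omega) (by omega), pitman_right]
  rw [pitman_of_ne h1 h2]
  by_cases h3 : l = j
  · subst h3
    rw [pitman_left, pitman_left, e3, e4]
  by_cases h4 : l = j + 1
  · subst h4
    rw [pitman_right, pitman_right, e3, e4]
  rw [pitman_of_ne h3 h4, pitman_of_ne h3 h4, pitman_of_ne h1 h2]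

/-- One time step of the braid relation.  Here `u` and `v` are the differences of consecutive
coordinates, `x`, `y`, `z` the amounts by which the transforms with indices `i`, `i + 1`, `i` push
the path, `x'`, `y'`, `z'` those for `i + 1`, `i`, `i + 1`, and the other variables are the values
after the step.  The two triples are related by the transition map between the string
parametrizations for the two reduced words of the longest permutation of three letters. -/
theorem braid_step {u v x y z x' y' z' u₁ v₁ X Y Z X' Y' Z' : ℤ}
    (hs : (u₁ = u ∧ v₁ = v) ∨ (u₁ = u + 1 ∧ v₁ = v) ∨ (u₁ = u - 1 ∧ v₁ = v + 1) ∨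
      (u₁ = u ∧ v₁ = v - 1))
    (hx : -u ≤ x) (hy : -(v - x) ≤ y) (hz : -(u + 2 * x - y) ≤ z)
    (hx' : -v ≤ x') (hy' : -(u - x') ≤ y') (hz' : -(v + 2 * x' - y') ≤ z')
    (hz0 : 0 ≤ z) (hz0' : 0 ≤ z')
    (hX : X = max x (-u₁)) (hY : Y = max y (-(v₁ - X))) (hZ : Z = max z (-(u₁ + 2 * X - Y)))
    (hX' : X' = max x' (-v₁)) (hY' : Y' = max y' (-(u₁ - X')))
    (hZ' : Z' = max z' (-(v₁ + 2 * X' - Y')))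
    (ih : z ≤ y ∧ x' = max z (y - x) ∧ y' = x + z ∧ z' = min x (y - z)) :
    Z ≤ Y ∧ X' = max Z (Y - X) ∧ Y' = X + Z ∧ Z' = min X (Y - Z) := by
  obtain ⟨i0, i1, i2, i3⟩ := ih
  rcases hs with ⟨rfl, rfl⟩ | ⟨rfl, rfl⟩ | ⟨rfl, rfl⟩ | ⟨rfl, rfl⟩
  · have e1 : X = x := by omega
    have e2 : Y = y := by omega
    have e3 : Z = z := by omega
    have e4 : X' = x' := by omega
    have e5 : Y' = y' := by omega
    have e6 : Z' = z' := by omega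
    subst e1 e2 e3 e4 e5 e6
    exact ⟨i0, i1, i2, i3⟩
  · have e1 : X = x := by clear i1 i3 hZ hX' hY' hZ'; omega
    have e2 : Y = y := by clear i1 i3 hZ hX' hY' hZ'; omega
    have e3 : Z = z := by clear i1 i3 hX' hY' hZ'; omega
    have e4 : X' = x' := by clear i1 i3 hX hY hZ hY' hZ'; omega
    have e5 : Y' = y' := by clear i1 i3 hX hY hZ hZ'; omega
    have e6 : Z' = z' := by clear i1 i3 hX hY hZ; omega
    subst e1 e2 e3 e4 e5 e6
    exact ⟨i0, i1, i2, i3⟩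
  · have e1 : (X = x ∧ -u < x) ∨ (X = x + 1 ∧ -u = x) := by
      clear i1 i3 hY hZ hX' hY' hZ'; omega
    have e4 : X' = x' := by clear i1 i3 hX hY hZ hY' hZ'; omega
    have e2 : Y = y := by clear i1 i3 hX hZ hX' hY' hZ'; omega
    clear hX hX' hY
    subst e4 e2
    -- The transition map is linear on each of two cones.
    have i : (X' = z ∧ z' = Y - z ∧ Y ≤ x + z) ∨ (X' = Y - x ∧ z' = x ∧ x + z < Y) := by
      clear hZ hY' hZ'; omega
    clear i1 i3
    rcases i with ⟨rfl, rfl, i⟩ | ⟨rfl, rfl, i⟩ <;> rcases e1 with ⟨rfl, h⟩ | ⟨rfl, h⟩ <;> omega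
  · have e1 : X = x := by clear i1 i3 hY hZ hX' hY' hZ'; omega
    subst e1
    have e2 : (Y = y ∧ -(v - X) < y) ∨ (Y = y + 1 ∧ -(v - X) = y) := by
      clear i1 i3 hX hZ hX' hY' hZ'; omega
    have e4 : (X' = x' ∧ -v < x') ∨ (X' = x' + 1 ∧ -v = x') := by
      clear i1 i3 hY hZ hY' hZ'; omega
    have i : (x' = z ∧ z' = y - z ∧ y ≤ X + z) ∨ (x' = y - X ∧ z' = X ∧ X + z < y) := by
      clear hZ hY' hZ' e2 e4; omega
    clear hX hX' hY i1 i3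
    rcases i with ⟨rfl, rfl, i⟩ | ⟨rfl, rfl, i⟩ <;> rcases e2 with ⟨rfl, h⟩ | ⟨rfl, h⟩ <;>
    rcases e4 with ⟨rfl, k⟩ | ⟨rfl, k⟩ <;> omega

/-- The relation of `braid_step` at all times.  It is essential that only one coordinate grows at a
time, and by one: for discrete paths with larger steps the braid relation fails. -/
theorem excess_braid (a b c x y z x' y' z' : ℕ → ℤ)
    (h0 : a 0 = 0 ∧ b 0 = 0 ∧ c 0 = 0)
    (hs : ∀ t, a t ≤ a (t + 1) ∧ b t ≤ b (t + 1) ∧ c t ≤ c (t + 1) ∧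
      a (t + 1) + b (t + 1) + c (t + 1) ≤ a t + b t + c t + 1)
    (hx : x = excess fun s => a s - b s)
    (hy : y = excess fun s => b s - x s - c s)
    (hz : z = excess fun s => a s + x s - (b s - x s + y s))
    (hx' : x' = excess fun s => b s - c s)
    (hy' : y' = excess fun s => a s - (b s + x' s))
    (hz' : z' = excess fun s => b s + x' s - y' s - (c s - x' s)) (t : ℕ) :
    z t ≤ y t ∧ x' t = max (z t) (y t - x t) ∧ y' t = x t + z t ∧
      z' t = min (x t) (y t - z t) := by
  have step {u D : ℕ → ℤ} (h : u = excess D) : u 0 = max 0 (-D 0) ∧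
      ∀ t, 0 ≤ u t ∧ -D t ≤ u t ∧ u (t + 1) = max (u t) (-D (t + 1)) := by
    subst h
    exact ⟨rfl, fun t => ⟨excess_nonneg _ _, neg_le_excess _ _, rfl⟩⟩
  obtain ⟨x0, xs⟩ := step hx
  obtain ⟨y0, ys⟩ := step hy
  obtain ⟨z0, zs⟩ := step hz
  obtain ⟨x0', xs'⟩ := step hx'
  obtain ⟨y0', ys'⟩ := step hy'
  obtain ⟨z0', zs'⟩ := step hz'
  clear step hx hy hz hx' hy' hz'
  induction t with
  | zero => omega
  | succ t ih =>
    have hu : (a (t + 1) - b (t + 1) = a t - b t ∧ b (t + 1) - c (t + 1) = b t - c t) ∨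
        (a (t + 1) - b (t + 1) = a t - b t + 1 ∧ b (t + 1) - c (t + 1) = b t - c t) ∨
        (a (t + 1) - b (t + 1) = a t - b t - 1 ∧ b (t + 1) - c (t + 1) = b t - c t + 1) ∨
        (a (t + 1) - b (t + 1) = a t - b t ∧ b (t + 1) - c (t + 1) = b t - c t - 1) := by
      have := hs t
      clear ih x0 y0 z0 x0' y0' z0'
      omega
    obtain ⟨-, xq, xs⟩ := xs t
    obtain ⟨-, yq, ys⟩ := ys t
    obtain ⟨zp, zq, zs⟩ := zs t
    obtain ⟨-, xq', xs'⟩ := xs' t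
    obtain ⟨-, yq', ys'⟩ := ys' t
    obtain ⟨zp', zq', zs'⟩ := zs' t
    refine braid_step hu xq ?_ ?_ xq' ?_ ?_ zp zp' xs ?_ ?_ xs' ?_ ?_ ih
    · linarith
    · linarith
    · linarith
    · linarith
    · rw [ys]; ring_nf
    · rw [zs]; ring_nf
    · rw [ys']; ring_nf
    · rw [zs']; ring_nf

/-- The lattice path of a word: it starts at `0`, and in every step at most one coordinate grows,
by one. -/
structure IsWordPath (p : ℕ → ℕ → ℤ) : Prop where
  zero : ∀ j, p j 0 = 0
  step : ∀ t, ∃ l, ∀ j, p j t ≤ p j (t + 1) ∧ p j (t + 1) ≤ p j t + if j = l then 1 else 0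

theorem IsWordPath.pitman {p : ℕ → ℕ → ℤ} (hp : IsWordPath p) (i : ℕ) :
    IsWordPath (pitman i p) := by
  constructor
  · intro j
    simp [_root_.pitman, excess, hp.zero]
  · intro t
    obtain ⟨l, hl⟩ := hp.step t
    have hi := hl i
    have hi' := hl (i + 1)
    have hE : excess (fun s => p i s - p (i + 1) s) (t + 1) =
      max (excess (fun s => p i s - p (i + 1) s) t) (-(p i (t + 1) - p (i + 1) (t + 1))) := rfl
    have hge : -(p i t - p (i + 1) t) ≤ excess (fun s => p i s - p (i + 1) s) t :=
      neg_le_excess _ t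
    -- A letter `i + 1` that increases the excess is turned into a letter `i`.
    by_cases hc : excess (fun s => p i s - p (i + 1) s) (t + 1) =
        excess (fun s => p i s - p (i + 1) s) t
    · refine ⟨l, fun j => ?_⟩
      have hj := hl j
      simp only [_root_.pitman, hc]
      split_ifs at * <;> subst_vars <;> constructor <;> omega
    · refine ⟨i, fun j => ?_⟩
      have hj := hl j
      simp only [_root_.pitman]
      split_ifs at * <;> subst_vars <;> constructor <;> omega

theorem pitman_braid (i : ℕ) {p : ℕ → ℕ → ℤ} (hp : IsWordPath p) :
    pitman i (pitman (i + 1) (pitman i p)) =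
      pitman (i + 1) (pitman i (pitman (i + 1) p)) := by
  funext l t
  have key := excess_braid (p i) (p (i + 1)) (p (i + 2)) _ _ _ _ _ _
    ⟨hp.zero _, hp.zero _, hp.zero _⟩ (fun t => by
      obtain ⟨l, hl⟩ := hp.step t
      have h0 := hl i
      have h1 := hl (i + 1)
      have h2 := hl (i + 2)
      split_ifs at * <;> omega) rfl rfl rfl rfl rfl rfl t
  have n1 (q : ℕ → ℕ → ℤ) : pitman i q (i + 2) = q (i + 2) :=
    pitman_of_ne (by omega) (by omega) q
  have n2 (q : ℕ → ℕ → ℤ) : pitman (i + 1) q i = q i :=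
    pitman_of_ne (by omega) (by omega) q
  by_cases h1 : l = i
  · subst h1
    simp only [pitman_left, pitman_right, n1, n2, add_assoc, Nat.reduceAdd] at *
    omega
  by_cases h2 : l = i + 1
  · subst h2
    simp only [pitman_left, pitman_right, n1, n2, add_assoc, Nat.reduceAdd] at *
    omega
  by_cases h3 : l = i + 2
  · subst h3
    simp only [pitman_left, pitman_right, n1, n2, add_assoc, Nat.reduceAdd] at *
    omega
  rw [pitman_of_ne h1 h2, pitman_of_ne h2 h3, pitman_of_ne h1 h2, pitman_of_ne h2 h3,
    pitman_of_ne h1 h2, pitman_of_ne h2 h3]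

/-! ### The Pitman transform of the longest permutation -/

/-- The Pitman transforms `pitman 0`, …, `pitman (n - 1)`, applied in this order. -/
def sweep : ℕ → (ℕ → ℕ → ℤ) → ℕ → ℕ → ℤ
  | 0, p => p
  | n + 1, p => pitman n (sweep n p)

/-- The composition of Pitman transforms along the reduced word
`0, …, n - 1, 0, …, n - 2, …, 0, 1, 0` of the longest permutation of `n + 1` coordinates. -/
def longestPitman : ℕ → (ℕ → ℕ → ℤ) → ℕ → ℕ → ℤ
  | 0, p => p
  | n + 1, p => longestPitman n (sweep (n + 1) p)

theorem IsWordPath.sweep {p : ℕ → ℕ → ℤ} (hp : IsWordPath p) (n : ℕ) :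
    IsWordPath (sweep n p) := by
  induction n with
  | zero => exact hp
  | succ n ih => exact ih.pitman n

theorem sweep_pitman_of_lt {n j : ℕ} (h : n < j) (p : ℕ → ℕ → ℤ) :
    sweep n (pitman j p) = pitman j (sweep n p) := by
  induction n with
  | zero => rfl
  | succ n ih => rw [sweep, ih (by omega), pitman_comm (by omega), sweep]

theorem sweep_pitman_zero (n : ℕ) (p : ℕ → ℕ → ℤ) :
    sweep (n + 1) (pitman 0 p) = sweep (n + 1) p := by
  induction n with
  | zero => exact pitman_idem 0 p
  | succ n ih => rw [sweep, ih, ← sweep]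

theorem sweep_pitman_succ {n i : ℕ} (h : i + 1 < n) {p : ℕ → ℕ → ℤ} (hp : IsWordPath p) :
    sweep n (pitman (i + 1) p) = pitman i (sweep n p) := by
  induction n, h using Nat.le_induction with
  | base =>
    simp only [sweep]
    rw [sweep_pitman_of_lt (by omega), ← pitman_braid i (hp.sweep i)]
  | succ n hn ih => rw [sweep, ih, ← pitman_comm (by omega), ← sweep]

/-- The longest Pitman transform is a zero element of the `0`-Hecke monoid. -/
theorem longestPitman_pitman {n i : ℕ} (h : i < n) {p : ℕ → ℕ → ℤ} (hp : IsWordPath p) :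
    longestPitman n (pitman i p) = longestPitman n p := by
  induction n generalizing i p with
  | zero => omega
  | succ n ih =>
    cases i with
    | zero => rw [longestPitman, sweep_pitman_zero, ← longestPitman]
    | succ i =>
      rw [longestPitman, sweep_pitman_succ h hp, ih (by omega) (hp.sweep _), ← longestPitman]

theorem longestPitman_eq_self {p : ℕ → ℕ → ℤ} (h : ∀ i t, p (i + 1) t ≤ p i t) (n : ℕ) :
    longestPitman n p = p := by
  have hs (n : ℕ) : sweep n p = p := by
    induction n with
    | zero => rfl
    | succ n ih => rw [sweep, ih, pitman_eq_self (h n)]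
  induction n with
  | zero => rfl
  | succ n ih => rw [longestPitman, hs, ih]

/-- Raising the path by the simple root `e i - e (i + 1)` from the first time on at which
`p i - p (i + 1)` attains its minimum, which is a crystal raising operator on the word of steps,
does not change the Pitman transform. -/
theorem pitman_eq_of_raise {i x : ℕ} {p q : ℕ → ℕ → ℤ}
    (hne : ∀ j, j ≠ i → j ≠ i + 1 → q j = p j)
    (hi : ∀ t, q i t = p i t + if x ≤ t then 1 else 0)
    (hi' : ∀ t, q (i + 1) t = p (i + 1) t - if x ≤ t then 1 else 0)
    (hneg : p i x - p (i + 1) x < 0)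
    (hmin : ∀ t, p i x - p (i + 1) x ≤ p i t - p (i + 1) t)
    (hlt : ∀ t < x, p i x - p (i + 1) x < p i t - p (i + 1) t)
    (hprev : ∀ t, t + 1 = x → p i t - p (i + 1) t = p i x - p (i + 1) x + 1)
    (hx : 0 < x) :
    pitman i q = pitman i p := by
  set D : ℕ → ℤ := fun s => p i s - p (i + 1) s with hD
  have key (t : ℕ) : excess (fun s => q i s - q (i + 1) s) t =
      excess D t - if x ≤ t then 1 else 0 := by
    by_cases hxt : x ≤ t
    · have h1 : excess D t = - D x :=
        le_antisymm (excess_le (by simp only [hD]; omega) fun s _ => by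
          have := hmin s
          simp only [hD]
          omega) ((neg_le_excess D x).trans (excess_mono D hxt))
      rw [h1, if_pos hxt]
      apply le_antisymm
      · refine excess_le (by simp only [hD]; omega) fun s _ => ?_
        have h2 := hi s
        have h3 := hi' s
        have h4 := hmin s
        by_cases hs : x ≤ s
        · rw [if_pos hs] at h2 h3
          simp only [hD]
          omega
        · rw [if_neg hs] at h2 h3
          have := hlt s (by omega)
          simp only [hD]
          omega
      · have h2 := hi (x - 1)
        have h3 := hi' (x - 1)
        have h4 := hprev (x - 1) (by omega)
        rw [if_neg (by omega)] at h2 h3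
        refine le_trans ?_ (excess_mono _ (show x - 1 ≤ t by omega))
        refine le_trans ?_ (neg_le_excess _ (x - 1))
        simp only [hD]
        omega
    · rw [if_neg hxt, sub_zero]
      refine excess_congr fun s hs => ?_
      have h2 := hi s
      have h3 := hi' s
      rw [if_neg (by omega)] at h2 h3
      simp only [hD]
      omega
  funext j t
  have h2 := hi t
  have h3 := hi' t
  have h4 := key t
  simp only [pitman, show excess (fun s => p i s - p (i + 1) s) = excess D from rfl]
  split_ifs with c1 c2
  · omega
  · omega
  · rw [hne j c1 c2]

/-! ### Stabilization of periodic paths -/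

/-- From time `q * m` up to time `K` the `i`-th coordinate of `p'` moves as that of `p` does. -/
def Settled (m K : ℕ) (p p' : ℕ → ℕ → ℤ) (q i : ℕ) : Prop :=
  ∃ c : ℤ, ∀ t, q * m ≤ t → t ≤ K → p' i t = p i t + c

theorem Settled.mono {m K : ℕ} {p p' : ℕ → ℕ → ℤ} {q q' i : ℕ} (h : Settled m K p p' q i)
    (hq : q ≤ q') : Settled m K p p' q' i := by
  obtain ⟨c, hc⟩ := h
  exact ⟨c, fun t h1 h2 => hc t ((Nat.mul_le_mul_right m hq).trans h1) h2⟩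

theorem excess_eq_of_le_add {D : ℕ → ℤ} {m K A : ℕ} (hm : 0 < m)
    (hD : ∀ t, A ≤ t → t + m ≤ K → D t ≤ D (t + m)) {t : ℕ} (h : A + m ≤ t) (hK : t ≤ K) :
    excess D t = excess D (A + m) := by
  induction t, h using Nat.le_induction with
  | base => rfl
  | succ t ht ih =>
    rw [← ih (by omega)]
    refine max_eq_left ?_
    have h1 := hD (t + 1 - m) (by omega) (by omega)
    rw [show t + 1 - m + m = t + 1 by omega] at h1
    have h2 := neg_le_excess D (t + 1 - m)
    have h3 := excess_mono D (show t + 1 - m ≤ t by omega)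
    omega

/-- If the path is periodic with a dominant period, a Pitman transform disturbs just one more
period: later the difference of the two coordinates attains no new minimum. -/
theorem Settled.pitman {m K : ℕ} (hm : 0 < m) {p p' : ℕ → ℕ → ℤ} {q i : ℕ}
    (hp : ∀ t, t + m ≤ K → p i t - p (i + 1) t ≤ p i (t + m) - p (i + 1) (t + m))
    (h : Settled m K p p' q i) (h' : Settled m K p p' q (i + 1)) :
    Settled m K p (pitman i p') (q + 1) i ∧ Settled m K p (pitman i p') (q + 1) (i + 1) := by
  obtain ⟨c, hc⟩ := h
  obtain ⟨c', hc'⟩ := h'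
  have key (t : ℕ) (h1 : (q + 1) * m ≤ t) (h2 : t ≤ K) :
      excess (fun s => p' i s - p' (i + 1) s) t =
        excess (fun s => p' i s - p' (i + 1) s) (q * m + m) := by
    refine excess_eq_of_le_add hm (fun s hs hsK => ?_) (by rwa [← Nat.succ_mul]) h2
    have := hp s hsK
    have := hc s hs (by omega)
    have := hc' s hs (by omega)
    have := hc (s + m) (by omega) hsK
    have := hc' (s + m) (by omega) hsK
    omega
  have hq : q * m ≤ (q + 1) * m := Nat.mul_le_mul_right m (Nat.le_succ q)
  refine ⟨⟨c + excess (fun s => p' i s - p' (i + 1) s) (q * m + m), fun t h1 h2 => ?_⟩,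
    ⟨c' - excess (fun s => p' i s - p' (i + 1) s) (q * m + m), fun t h1 h2 => ?_⟩⟩
  · rw [pitman_left, key t h1 h2, hc t (by omega) h2]
    ring
  · rw [pitman_right, key t h1 h2, hc' t (by omega) h2]
    ring

theorem sweep_of_lt {n j : ℕ} (h : n < j) (p : ℕ → ℕ → ℤ) : sweep n p j = p j := by
  induction n with
  | zero => rfl
  | succ n ih => rw [sweep, pitman_of_ne (by omega) (by omega), ih (by omega)]

theorem longestPitman_of_lt {n j : ℕ} (h : n < j) (p : ℕ → ℕ → ℤ) :
    longestPitman n p j = p j := by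
  induction n generalizing p with
  | zero => rfl
  | succ n ih => rw [longestPitman, ih (by omega), sweep_of_lt h]

theorem Settled.sweep {m K : ℕ} (hm : 0 < m) {p p' : ℕ → ℕ → ℤ} {A n : ℕ}
    (hp : ∀ i t, t + m ≤ K → p i t - p (i + 1) t ≤ p i (t + m) - p (i + 1) (t + m))
    (h0 : Settled m K p p' A 0) (hs : ∀ i < n, Settled m K p p' (A + i) (i + 1)) :
    (∀ i < n, Settled m K p (sweep n p') (A + i + 1) i) ∧
      Settled m K p (sweep n p') (A + n) n := by
  induction n with
  | zero => exact ⟨fun i hi => by omega, h0⟩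
  | succ n ih =>
    obtain ⟨h1, h2⟩ := ih fun i hi => hs i (by omega)
    have h3 : Settled m K p (_root_.sweep n p') (A + n) (n + 1) := by
      obtain ⟨c, hc⟩ := hs n (by omega)
      exact ⟨c, by rwa [sweep_of_lt (by omega)]⟩
    obtain ⟨h4, h5⟩ := h2.pitman hm (hp n) h3
    refine ⟨fun i hi => ?_, h5⟩
    rcases Nat.lt_succ_iff_lt_or_eq.1 hi with hi | rfl
    · obtain ⟨c, hc⟩ := h1 i hi
      exact ⟨c, by rwa [_root_.sweep, pitman_of_ne (by omega) (by omega)]⟩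
    · exact h4

/-- The transforms of the reduced word can be performed in `2 * n + 1` rounds of commuting
transforms, where `pitman i` of the `k`-th sweep belongs to round `i + 2 * k`, and each round
disturbs one more period. -/
theorem Settled.longestPitman {m K : ℕ} (hm : 0 < m) {p p' : ℕ → ℕ → ℤ} {A n : ℕ}
    (hp : ∀ i t, t + m ≤ K → p i t - p (i + 1) t ≤ p i (t + m) - p (i + 1) (t + m))
    (h0 : Settled m K p p' A 0) (hs : ∀ i ≤ n, Settled m K p p' (A + i) (i + 1)) :
    ∀ i ≤ n + 1, Settled m K p (longestPitman (n + 1) p') (A + 2 * n + 1) i := by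
  induction n generalizing A p' with
  | zero =>
    obtain ⟨h1, h2⟩ := Settled.sweep hm (n := 1) hp h0 fun i hi => hs i (by omega)
    intro i hi
    rcases Nat.le_one_iff_eq_zero_or_eq_one.1 hi with rfl | rfl
    · exact h1 0 one_pos
    · exact h2
  | succ n ih =>
    obtain ⟨h1, h2⟩ := Settled.sweep hm (n := n + 2) hp h0 fun i hi => hs i (by omega)
    intro i hi
    rcases hi.eq_or_lt with rfl | hi
    · obtain ⟨c, hc⟩ := h2.mono (show A + (n + 2) ≤ A + 2 * (n + 1) + 1 by omega)
      exact ⟨c, by rwa [_root_.longestPitman, longestPitman_of_lt (by omega)]⟩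
    · refine (ih (A := A + 2) ((h1 0 (by omega)).mono (by omega)) (fun i hi => ?_) i
        (by omega)).mono (by omega)
      exact (h1 (i + 1) (by omega)).mono (by omega)

/-! ### Jeu de taquin slides -/

/-- The lattice path of a filling `f`, in which `0` marks the empty cells: the `i`-th coordinate at
time `t` is the number of entries at most `t` in row `i`. -/
noncomputable def rowPath (f : ℕ × ℕ → ℕ) (i t : ℕ) : ℤ :=
  ({j | f (i, j) ≠ 0 ∧ f (i, j) ≤ t} : Set ℕ).ncard

/-- No entry occurs twice in the filling `f`. -/
def EntriesDistinct (f : ℕ × ℕ → ℕ) : Prop := ∀ c c', f c ≠ 0 → f c = f c' → c = c'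

theorem isWordPath_rowPath {f : ℕ × ℕ → ℕ} (hf : EntriesDistinct f)
    (hfin : ∀ i, {j | f (i, j) ≠ 0}.Finite) : IsWordPath (rowPath f) := by
  constructor
  · intro i
    have : {j | f (i, j) ≠ 0 ∧ f (i, j) ≤ 0} = (∅ : Set ℕ) :=
      Set.eq_empty_of_forall_notMem fun j hj => hj.1 (Nat.le_zero.1 hj.2)
    simp only [rowPath, this, Set.ncard_empty, Nat.cast_zero]
  · intro t
    have hfin' (i t : ℕ) : {j | f (i, j) ≠ 0 ∧ f (i, j) ≤ t}.Finite :=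
      (hfin i).subset fun j hj => hj.1
    have hmono (i : ℕ) : rowPath f i t ≤ rowPath f i (t + 1) :=
      Nat.cast_le.2 (Set.ncard_le_ncard (fun j hj => ⟨hj.1, hj.2.trans (Nat.le_succ t)⟩)
        (hfin' i (t + 1)))
    have hsame (i : ℕ) (h : ∀ j, f (i, j) ≠ t + 1) : rowPath f i (t + 1) = rowPath f i t := by
      unfold rowPath
      congr 3
      ext j
      have := h j
      exact ⟨fun hj => ⟨hj.1, by have := hj.2; omega⟩, fun hj => ⟨hj.1, by have := hj.2; omega⟩⟩
    by_cases hex : ∃ c, f c = t + 1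
    · obtain ⟨⟨l, k⟩, hc⟩ := hex
      refine ⟨l, fun i => ⟨hmono i, ?_⟩⟩
      split_ifs with hi
      · subst hi
        have h1 := Set.ncard_le_ncard (s := {j | f (i, j) ≠ 0 ∧ f (i, j) ≤ t + 1})
          (t := insert k {j | f (i, j) ≠ 0 ∧ f (i, j) ≤ t}) (fun j hj => by
            by_cases hjk : j = k
            · exact Or.inl hjk
            · refine Or.inr ⟨hj.1, Nat.le_of_lt_succ (lt_of_le_of_ne hj.2 fun h => hjk ?_)⟩
              exact (Prod.mk.inj (hf _ _ hj.1 (h.trans hc.symm))).2) ((hfin' i t).insert k)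
        have h2 := h1.trans (Set.ncard_insert_le _ _)
        unfold rowPath
        exact_mod_cast h2
      · rw [hsame i fun j hj => hi ?_, add_zero]
        exact (Prod.mk.inj (hf _ _ (by omega) (hj.trans hc.symm))).1
    · push Not at hex
      exact ⟨0, fun i => ⟨hmono i, by rw [hsame i fun j => hex _]; split_ifs <;> omega⟩⟩

/-- The filling `f` of the skew shape `Y / M`, in which only the cell `h` is empty, has distinct
entries, which increase along rows and columns. -/
structure HoleTableau (Y M : YoungDiagram) (f : ℕ × ℕ → ℕ) (h : ℕ × ℕ) : Prop where
  hole_mem : h ∈ Y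
  hole_notMem : h ∉ M
  ne_zero_iff : ∀ c, f c ≠ 0 ↔ c ∈ Y ∧ c ∉ M ∧ c ≠ h
  lt : ∀ c c', c ≤ c' → c ≠ c' → f c ≠ 0 → f c' ≠ 0 → f c < f c'
  distinct : EntriesDistinct f

namespace HoleTableau

variable {Y M : YoungDiagram} {f : ℕ × ℕ → ℕ} {h : ℕ × ℕ}

theorem zero (H : HoleTableau Y M f h) : f h = 0 := by
  by_contra h0
  exact ((H.ne_zero_iff h).1 h0).2.2 rfl

theorem mem_of_le (H : HoleTableau Y M f h) {c : ℕ × ℕ} (hc : c ∈ Y) (hle : h ≤ c) (hne : c ≠ h) :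
    f c ≠ 0 :=
  (H.ne_zero_iff c).2 ⟨hc, fun hM => H.hole_notMem (M.isLowerSet hle hM), hne⟩

theorem le (H : HoleTableau Y M f h) {c c' : ℕ × ℕ} (hle : c ≤ c') (hc : f c ≠ 0)
    (hc' : f c' ≠ 0) : f c ≤ f c' := by
  by_cases h1 : c = c'
  · rw [h1]
  · exact (H.lt c c' hle h1 hc hc').le

theorem finite_row (H : HoleTableau Y M f h) (i : ℕ) : {j | f (i, j) ≠ 0}.Finite :=
  (Set.finite_Iio (Y.rowLen i)).subset fun _ hj =>
    YoungDiagram.mem_iff_lt_rowLen.1 ((H.ne_zero_iff _).1 hj).1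

theorem isWordPath (H : HoleTableau Y M f h) : IsWordPath (rowPath f) :=
  isWordPath_rowPath H.distinct H.finite_row

/-- Moving the smallest entry `f c` to the right of or below the hole into the hole. -/
theorem move (H : HoleTableau Y M f h) {c : ℕ × ℕ} (hc : c ∈ Y) (hle : h ≤ c) (hne : c ≠ h)
    (hmin : ∀ c', h ≤ c' → c' ≠ h → c' ≠ c → f c' ≠ 0 → f c < f c') :
    HoleTableau Y M (Function.update (Function.update f h (f c)) c 0) c := by
  have hfc := H.mem_of_le hc hle hne
  have e1 : Function.update (Function.update f h (f c)) c 0 c = 0 := Function.update_self ..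
  have e2 : Function.update (Function.update f h (f c)) c 0 h = f c := by
    rw [Function.update_of_ne hne.symm, Function.update_self]
  have e3 (d : ℕ × ℕ) (h1 : d ≠ h) (h2 : d ≠ c) :
      Function.update (Function.update f h (f c)) c 0 d = f d := by
    rw [Function.update_of_ne h2, Function.update_of_ne h1]
  generalize Function.update (Function.update f h (f c)) c 0 = g at *
  refine ⟨hc, ((H.ne_zero_iff c).1 hfc).2.1, fun d => ?_, fun d d' hd hdd h1 h2 => ?_,
    fun d d' h1 h2 => ?_⟩
  · by_cases hd : d = h
    · subst hd
      rw [e2]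
      exact iff_of_true hfc ⟨H.hole_mem, H.hole_notMem, hne.symm⟩
    by_cases hd' : d = c
    · subst hd'
      exact iff_of_false (fun h => h e1) fun h => h.2.2 rfl
    rw [e3 d hd hd', H.ne_zero_iff]
    simp [hd, hd']
  · have hdc : d ≠ c := fun h => h1 (h ▸ e1)
    have hdc' : d' ≠ c := fun h => h2 (h ▸ e1)
    by_cases hd1 : d = h
    · subst hd1
      rw [e3 d' hdd.symm hdc'] at h2 ⊢
      rw [e2]
      exact hmin d' hd hdd.symm hdc' h2
    rw [e3 d hd1 hdc] at h1 ⊢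
    by_cases hd2 : d' = h
    · subst hd2
      rw [e2]
      exact H.lt d c (hd.trans hle) hdc h1 hfc
    rw [e3 d' hd2 hdc'] at h2 ⊢
    exact H.lt d d' hd hdd h1 h2
  · have hdc : d ≠ c := fun h => h1 (h ▸ e1)
    have hdc' : d' ≠ c := fun h => h1 (h2.trans (h ▸ e1))
    by_cases hd1 : d = h
    · by_cases hd2 : d' = h
      · rw [hd1, hd2]
      · rw [hd1, e2, e3 d' hd2 hdc'] at h2
        exact (hdc' (H.distinct _ _ hfc h2).symm).elim
    · rw [e3 d hd1 hdc] at h1 h2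
      by_cases hd2 : d' = h
      · rw [hd2, e2] at h2
        exact (hdc (H.distinct _ _ h1 h2)).elim
      · rw [e3 d' hd2 hdc'] at h2
        exact H.distinct _ _ h1 h2

theorem move_right {i j : ℕ} (H : HoleTableau Y M f (i, j)) (hr : (i, j + 1) ∈ Y)
    (hlt : (i + 1, j) ∈ Y → f (i, j + 1) < f (i + 1, j)) :
    HoleTableau Y M (Function.update (Function.update f (i, j) (f (i, j + 1))) (i, j + 1) 0)
      (i, j + 1) := by
  have hle : (i, j) ≤ (i, j + 1) := ⟨le_rfl, Nat.le_succ j⟩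
  refine H.move hr hle (by simp) ?_
  rintro ⟨k, l⟩ ⟨hk : i ≤ k, hl : j ≤ l⟩ h1 h2 h3
  have h4 := H.mem_of_le hr hle (by simp)
  by_cases hjl : j + 1 ≤ l
  · exact H.lt _ _ ⟨hk, hjl⟩ h2.symm h4 h3
  · obtain rfl : j = l := by omega
    have hik : i + 1 ≤ k := lt_of_le_of_ne hk fun h => h1 (by rw [h])
    have h5 := Y.up_left_mem hik le_rfl ((H.ne_zero_iff _).1 h3).1
    exact (hlt h5).trans_le
      (H.le (c := (i + 1, j)) ⟨hik, le_rfl⟩ (H.mem_of_le h5 ⟨Nat.le_succ i, le_rfl⟩ (by simp)) h3)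

theorem move_down {i j : ℕ} (H : HoleTableau Y M f (i, j)) (hd : (i + 1, j) ∈ Y)
    (hle : (i, j + 1) ∈ Y → f (i + 1, j) ≤ f (i, j + 1)) :
    HoleTableau Y M (Function.update (Function.update f (i, j) (f (i + 1, j))) (i + 1, j) 0)
      (i + 1, j) := by
  have hle' : (i, j) ≤ (i + 1, j) := ⟨Nat.le_succ i, le_rfl⟩
  refine H.move hd hle' (by simp) ?_
  rintro ⟨k, l⟩ ⟨hk : i ≤ k, hl : j ≤ l⟩ h1 h2 h3
  have h4 := H.mem_of_le hd hle' (by simp)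
  by_cases hik : i + 1 ≤ k
  · exact H.lt _ _ ⟨hik, hl⟩ h2.symm h4 h3
  · obtain rfl : i = k := by omega
    have hjl : j + 1 ≤ l := lt_of_le_of_ne hl fun h => h1 (by rw [h])
    have h5 := Y.up_left_mem le_rfl hjl ((H.ne_zero_iff _).1 h3).1
    exact lt_of_le_of_ne ((hle h5).trans
      (H.le (c := (i, j + 1)) ⟨le_rfl, hjl⟩ (H.mem_of_le h5 ⟨le_rfl, Nat.le_succ j⟩ (by simp)) h3))
      fun h => h2 (H.distinct _ _ h4 h).symm

theorem rowPath_move_right {i j : ℕ} (H : HoleTableau Y M f (i, j)) :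
    rowPath (Function.update (Function.update f (i, j) (f (i, j + 1))) (i, j + 1) 0) =
      rowPath f := by
  have h0 := H.zero
  have hswap : Function.update (Function.update f (i, j) (f (i, j + 1))) (i, j + 1) 0 =
      f ∘ Equiv.swap (i, j) (i, j + 1) := by
    funext c
    by_cases h1 : c = (i, j + 1)
    · subst h1
      simp [h0]
    by_cases h2 : c = (i, j)
    · subst h2
      simp
    simp [Function.update_of_ne h1, Function.update_of_ne h2, Equiv.swap_apply_of_ne_of_ne h2 h1]
  rw [hswap]
  funext k t
  unfold rowPath
  by_cases hk : k = i
  · subst hk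
    have hcell (l : ℕ) : Equiv.swap (k, j) (k, j + 1) (k, l) = (k, Equiv.swap j (j + 1) l) := by
      simp only [Equiv.swap_apply_def, Prod.mk.injEq, true_and]
      split_ifs <;> rfl
    have : {l | (f ∘ Equiv.swap (k, j) (k, j + 1)) (k, l) ≠ 0 ∧
        (f ∘ Equiv.swap (k, j) (k, j + 1)) (k, l) ≤ t} =
        Equiv.swap j (j + 1) '' {l | f (k, l) ≠ 0 ∧ f (k, l) ≤ t} := by
      rw [Equiv.image_eq_preimage_symm, Equiv.symm_swap]
      ext l
      simp only [Function.comp_apply, hcell]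
      rfl
    rw [this, Set.ncard_image_of_injective _ (Equiv.injective _)]
  · simp only [Function.comp_apply]
    congr 3
    ext l
    rw [Equiv.swap_apply_of_ne_of_ne (by simp [hk]) (by simp [hk])]

/-- When an entry moves up from row `i + 1` to row `i`, it is the first time at which
`rowPath f i - rowPath f (i + 1)` attains its minimum: up to this entry, row `i` is filled up to
the hole and row `i + 1` up to the column of the hole, while the strict increase in the columns
bounds the difference at all other times. -/
theorem pitman_move_down {i j : ℕ} (H : HoleTableau Y M f (i, j)) (hd : (i + 1, j) ∈ Y)
    (hle : (i, j + 1) ∈ Y → f (i + 1, j) ≤ f (i, j + 1)) :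
    pitman i
      (rowPath (Function.update (Function.update f (i, j) (f (i + 1, j))) (i + 1, j) 0)) =
      pitman i (rowPath f) := by
  set x := f (i + 1, j) with hx
  set A : ℕ → Set ℕ := fun t => {l | f (i, l) ≠ 0 ∧ f (i, l) ≤ t} with hA
  set B : ℕ → Set ℕ := fun t => {l | f (i + 1, l) ≠ 0 ∧ f (i + 1, l) ≤ t} with hB
  have hpA (t : ℕ) : rowPath f i t = (A t).ncard := rfl
  have hpB (t : ℕ) : rowPath f (i + 1) t = (B t).ncard := rfl
  have finA (t : ℕ) : (A t).Finite := (H.finite_row i).subset fun _ hl => hl.1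
  have finB (t : ℕ) : (B t).Finite := (H.finite_row (i + 1)).subset fun _ hl => hl.1
  have hx0 : x ≠ 0 := H.mem_of_le hd ⟨Nat.le_succ i, le_rfl⟩ (by simp)
  have h0 := H.zero
  have hMj : M.rowLen i ≤ j := by
    have := H.hole_notMem
    rwa [YoungDiagram.mem_iff_lt_rowLen, not_lt] at this
  have hMM : M.rowLen (i + 1) ≤ M.rowLen i := M.rowLen_anti _ _ (Nat.le_succ i)
  have hYj : j < Y.rowLen (i + 1) := YoungDiagram.mem_iff_lt_rowLen.1 hd
  have hYY : Y.rowLen (i + 1) ≤ Y.rowLen i := Y.rowLen_anti _ _ (Nat.le_succ i)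
  have nzA (l : ℕ) : f (i, l) ≠ 0 ↔ l < Y.rowLen i ∧ M.rowLen i ≤ l ∧ l ≠ j := by
    rw [H.ne_zero_iff, YoungDiagram.mem_iff_lt_rowLen, YoungDiagram.mem_iff_lt_rowLen, not_lt]
    simp
  have nzB (l : ℕ) : f (i + 1, l) ≠ 0 ↔ l < Y.rowLen (i + 1) ∧ M.rowLen (i + 1) ≤ l := by
    rw [H.ne_zero_iff, YoungDiagram.mem_iff_lt_rowLen, YoungDiagram.mem_iff_lt_rowLen, not_lt]
    simp
  have above (l : ℕ) (h1 : f (i, l) ≠ 0) (h2 : f (i + 1, l) ≠ 0) : f (i, l) < f (i + 1, l) :=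
    H.lt _ _ ⟨Nat.le_succ i, le_rfl⟩ (by simp) h1 h2
  have rowB (l l' : ℕ) (h : l < l') (h1 : f (i + 1, l) ≠ 0) (h2 : f (i + 1, l') ≠ 0) :
      f (i + 1, l) < f (i + 1, l') :=
    H.lt _ _ ⟨le_rfl, h.le⟩ (by simp [h.ne]) h1 h2
  have hAx : A x = Set.Ico (M.rowLen i) j := by
    ext l
    simp only [hA, Set.mem_ofPred_eq, Set.mem_Ico]
    constructor
    · rintro ⟨h1, h2⟩
      have h3 := (nzA l).1 h1
      refine ⟨h3.2.1, ?_⟩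
      by_contra hl
      -- The entries to the right of the hole are larger than `x`.
      have h4 : (i, j + 1) ∈ Y := YoungDiagram.mem_iff_lt_rowLen.2 (by omega)
      have h5 : f (i, j + 1) ≠ 0 := (nzA _).2 ⟨by omega, by omega, by omega⟩
      have h6 : f (i, j + 1) ≤ f (i, l) := H.le ⟨le_rfl, by dsimp only; omega⟩ h5 h1
      have h7 : x = f (i, l) := le_antisymm ((hle h4).trans h6) h2
      have := H.distinct (i + 1, j) (i, l) hx0 h7
      simp at this
    · rintro ⟨h1, h2⟩
      have h3 : f (i, l) ≠ 0 := (nzA l).2 ⟨by omega, h1, by omega⟩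
      have h4 : f (i + 1, l) ≠ 0 := (nzB l).2 ⟨by omega, by omega⟩
      exact ⟨h3, ((above l h3 h4).trans (rowB l j h2 h4 hx0)).le⟩
  have hBx : B x = Set.Ico (M.rowLen (i + 1)) (j + 1) := by
    ext l
    simp only [hB, Set.mem_ofPred_eq, Set.mem_Ico]
    constructor
    · rintro ⟨h1, h2⟩
      refine ⟨((nzB l).1 h1).2, ?_⟩
      by_contra hl
      exact absurd (rowB j l (by omega) hx0 h1) (by omega)
    · rintro ⟨h1, h2⟩
      have h3 : f (i + 1, l) ≠ 0 := (nzB l).2 ⟨by omega, h1⟩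
      rcases (show l ≤ j by omega).eq_or_lt with rfl | h4
      · exact ⟨h3, le_rfl⟩
      · exact ⟨h3, (rowB l j h4 h3 hx0).le⟩
  have cA : (A x).ncard = j - M.rowLen i := by
    rw [hAx, ← Finset.coe_Ico, Set.ncard_coe_finset, Nat.card_Ico]
  have cB : (B x).ncard = j + 1 - M.rowLen (i + 1) := by
    rw [hBx, ← Finset.coe_Ico, Set.ncard_coe_finset, Nat.card_Ico]
  have cI : (Set.Ico (M.rowLen (i + 1)) (M.rowLen i)).ncard = M.rowLen i - M.rowLen (i + 1) := by
    rw [← Finset.coe_Ico, Set.ncard_coe_finset, Nat.card_Ico]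
  have cover (t l : ℕ) (hl : l ∈ B t) (hlj : l ≠ j) :
      l ∈ Set.Ico (M.rowLen (i + 1)) (M.rowLen i) ∪ A t := by
    obtain ⟨h1, h2⟩ := hl
    have h3 := (nzB l).1 h1
    by_cases h4 : l < M.rowLen i
    · exact Or.inl ⟨h3.2, h4⟩
    · have h5 : f (i, l) ≠ 0 := (nzA l).2 ⟨by omega, by omega, hlj⟩
      exact Or.inr ⟨h5, (above l h5 h1).le.trans h2⟩
  have finU (t : ℕ) : (Set.Ico (M.rowLen (i + 1)) (M.rowLen i) ∪ A t).Finite :=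
    (Set.finite_Ico _ _).union (finA t)
  refine pitman_eq_of_raise (x := x) (fun k h1 h2 => ?_) (fun t => ?_) (fun t => ?_) ?_
    (fun t => ?_) (fun t ht => ?_) (fun t ht => ?_) (by omega)
  · funext t
    unfold rowPath
    congr 3
    ext l
    rw [Function.update_of_ne (by simp [h2]), Function.update_of_ne (by simp [h1])]
  · rw [hpA]
    unfold rowPath
    have hset : {l | Function.update (Function.update f (i, j) x) (i + 1, j) 0 (i, l) ≠ 0 ∧
        Function.update (Function.update f (i, j) x) (i + 1, j) 0 (i, l) ≤ t} =
        if x ≤ t then insert j (A t) else A t := by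
      ext l
      rw [Set.mem_ofPred_eq, Function.update_of_ne (by simp)]
      by_cases hl : l = j
      · subst hl
        rw [Function.update_self]
        split_ifs with h1
        · simp [hx0, h1]
        · simp [hA, h1, h0]
      · rw [Function.update_of_ne (by simp [hl])]
        split_ifs with h1 <;> simp [hA, hl]
    rw [hset]
    split_ifs with h1
    · rw [Set.ncard_insert_of_notMem (fun h => h.1 h0) (finA t)]
      push_cast
      rfl
    · rw [add_zero]
  · rw [hpB]
    unfold rowPath
    have hset : {l | Function.update (Function.update f (i, j) x) (i + 1, j) 0 (i + 1, l) ≠ 0 ∧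
        Function.update (Function.update f (i, j) x) (i + 1, j) 0 (i + 1, l) ≤ t} =
        B t \ {j} := by
      ext l
      by_cases hl : l = j
      · subst hl
        simp
      · rw [Set.mem_ofPred_eq, Function.update_of_ne (by simp [hl]),
          Function.update_of_ne (by simp)]
        simp [hB, hl]
    rw [hset]
    split_ifs with h1
    · have := Set.ncard_sdiff_singleton_add_one (s := B t) (a := j) ⟨hx0, h1⟩ (finB t)
      omega
    · rw [Set.sdiff_singleton_eq_self fun h => h1 h.2, sub_zero]
  · rw [hpA, hpB, cA, cB]
    omega
  · have h1 := Set.ncard_le_ncard (s := B t)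
      (t := insert j (Set.Ico (M.rowLen (i + 1)) (M.rowLen i) ∪ A t)) (fun l hl => by
        by_cases hlj : l = j
        · exact Or.inl hlj
        · exact Or.inr (cover t l hl hlj)) ((finU t).insert j)
    have h2 := Set.ncard_insert_le j (Set.Ico (M.rowLen (i + 1)) (M.rowLen i) ∪ A t)
    have h3 := Set.ncard_union_le (Set.Ico (M.rowLen (i + 1)) (M.rowLen i)) (A t)
    rw [hpA, hpB, hpA, hpB, cA, cB]
    omega
  · have h1 := Set.ncard_le_ncard (s := B t)
      (t := Set.Ico (M.rowLen (i + 1)) (M.rowLen i) ∪ A t) (fun l hl =>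
        cover t l hl fun hlj => by
          subst hlj
          exact absurd hl.2 (by omega)) (finU t)
    have h3 := Set.ncard_union_le (Set.Ico (M.rowLen (i + 1)) (M.rowLen i)) (A t)
    rw [hpA, hpB, hpA, hpB, cA, cB]
    omega
  · have eA : A x = A t := by
      ext l
      refine ⟨fun hl => ⟨hl.1, ?_⟩, fun hl => ⟨hl.1, hl.2.trans (by omega)⟩⟩
      have h1 : f (i, l) ≠ x := fun h => by
        have := H.distinct (i, l) (i + 1, j) hl.1 h
        simp at this
      have h2 := hl.2
      omega
    have eB : B x = insert j (B t) := by
      ext l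
      constructor
      · intro hl
        by_cases hlj : l = j
        · exact Or.inl hlj
        · have h1 : f (i + 1, l) ≠ x := fun h => by
            have := H.distinct (i + 1, l) (i + 1, j) hl.1 h
            simp [hlj] at this
          have h2 := hl.2
          exact Or.inr ⟨hl.1, by omega⟩
      · rintro (rfl | hl)
        · exact ⟨hx0, le_rfl⟩
        · exact ⟨hl.1, hl.2.trans (by omega)⟩
    have h1 : (B x).ncard = (B t).ncard + 1 := by
      rw [eB, Set.ncard_insert_of_notMem (fun h => ?_) (finB t)]
      have h2 : x ≤ t := h.2
      omega
    rw [hpA, hpB, hpA, hpB, ← eA, h1]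
    push_cast
    ring

end HoleTableau

namespace SkewTableau

theorem entry_ne_zero_iff (S : SkewTableau) (c : ℕ × ℕ) :
    S.entry c ≠ 0 ↔ c ∈ S.outer ∧ c ∉ S.inner := by
  constructor
  · intro h
    by_contra h'
    exact h (S.zero c h')
  · rintro ⟨h1, h2⟩
    exact (S.pos c h1 h2).ne'

/-- The states between two inner slides: a tableau whose hole is an outer corner of its inner
shape. -/
theorem holeTableau {S : SkewTableau} (hS : EntriesDistinct S.entry) {M : YoungDiagram}
    {c : ℕ × ℕ} (hc : IsOuterCorner S.inner c) (hM : M.cells = S.inner.cells.erase c) :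
    HoleTableau S.outer M S.entry c := by
  have hM' (d : ℕ × ℕ) : d ∈ M ↔ d ≠ c ∧ d ∈ S.inner := by
    rw [← YoungDiagram.mem_cells, hM, Finset.mem_erase, YoungDiagram.mem_cells]
  refine ⟨S.inner_le hc.1, fun h => ((hM' c).1 h).1 rfl, fun d => ?_, ?_, hS⟩
  · rw [S.entry_ne_zero_iff, hM']
    have h1 := hc.1
    constructor
    · rintro ⟨h2, h3⟩
      exact ⟨h2, fun h => h3 h.2, fun h => h3 (h ▸ h1)⟩
    · rintro ⟨h2, h3, h4⟩
      exact ⟨h2, fun h => h3 ⟨h4, h⟩⟩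
  · rintro ⟨i, j⟩ ⟨i', j'⟩ ⟨hi : i ≤ i', hj : j ≤ j'⟩ hne h1 h2
    refine lt_of_le_of_ne ?_ fun h => hne (hS _ _ h1 h)
    have h3 := ((S.entry_ne_zero_iff _).1 h1).2
    have h4 := ((S.entry_ne_zero_iff _).1 h2).1
    have h5 : (i, j') ∉ S.inner := fun h => h3 (S.inner.up_left_mem le_rfl hj h)
    have h6 : (i, j') ∈ S.outer := S.outer.up_left_mem hi le_rfl h4
    have h7 : S.entry (i, j) ≤ S.entry (i, j') := by
      rcases hj.eq_or_lt with rfl | hj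
      · exact le_rfl
      · exact S.row_weak _ _ _ hj h3 h6
    have h8 : S.entry (i, j') ≤ S.entry (i', j') := by
      rcases hi.eq_or_lt with rfl | hi
      · exact le_rfl
      · exact (S.col_strict _ _ _ hi h5 h4).le
    exact h7.trans h8

/-- Hole moves change neither the longest Pitman transform of the path nor the rows in which
entries may lie. -/
theorem holeMoves_invariant {Y M : YoungDiagram} {n : ℕ} {s s' : (ℕ × ℕ → ℕ) × (ℕ × ℕ)}
    (h : Relation.ReflTransGen (HoleMove Y) s s') (H : HoleTableau Y M s.1 s.2)
    (hn : ∀ i j, n < i → s.1 (i, j) = 0) :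
    HoleTableau Y M s'.1 s'.2 ∧ (∀ i j, n < i → s'.1 (i, j) = 0) ∧
      longestPitman n (rowPath s'.1) = longestPitman n (rowPath s.1) := by
  induction h with
  | refl => exact ⟨H, hn, rfl⟩
  | tail _ hm ih =>
    obtain ⟨H', hn', hp⟩ := ih
    cases hm with
    | right f i j hr hlt =>
      have hin : i ≤ n := by
        by_contra hi
        exact H'.mem_of_le hr ⟨le_rfl, Nat.le_succ j⟩ (by simp) (hn' i _ (by omega))
      refine ⟨H'.move_right hr hlt, fun k l hk => ?_, ?_⟩
      · have h1 : k ≠ i := by omega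
        simpa [h1] using hn' k l hk
      · rw [← hp]
        exact congrArg _ H'.rowPath_move_right
    | down f i j hd hle =>
      have hin : i + 1 ≤ n := by
        by_contra hi
        exact H'.mem_of_le hd ⟨Nat.le_succ i, le_rfl⟩ (by simp) (hn' (i + 1) _ (by omega))
      refine ⟨H'.move_down hd hle, fun k l hk => ?_, ?_⟩
      · have h1 : k ≠ i := by omega
        have h2 : k ≠ i + 1 := by omega
        simpa [h1, h2] using hn' k l hk
      · rw [← hp, ← longestPitman_pitman hin (H'.move_down hd hle).isWordPath,
          H'.pitman_move_down hd hle, longestPitman_pitman hin H'.isWordPath]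

theorem innerSlide_invariant {S S' : SkewTableau} {n : ℕ} (h : InnerSlide S S')
    (hS : EntriesDistinct S.entry) (hn : ∀ i j, n < i → S.entry (i, j) = 0) :
    EntriesDistinct S'.entry ∧ (∀ i j, n < i → S'.entry (i, j) = 0) ∧
      longestPitman n (rowPath S'.entry) = longestPitman n (rowPath S.entry) := by
  obtain ⟨c, e, hc, -, hm, hM, -⟩ := h
  obtain ⟨h1, h2, h3⟩ := holeMoves_invariant hm (holeTableau hS hc hM) hn
  exact ⟨h1.distinct, h2, h3⟩

/-- The path of a straight tableau is dominant, so it is the longest Pitman transform of the path of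
each skew tableau that rectifies to it. -/
theorem rowPath_rectification {S T : SkewTableau} {n : ℕ} (h : IsRectification S T)
    (hS : EntriesDistinct S.entry) (hn : ∀ i j, n < i → S.entry (i, j) = 0) :
    rowPath T.entry = longestPitman n (rowPath S.entry) := by
  obtain ⟨h, hT⟩ := h
  rw [← (show EntriesDistinct T.entry ∧ (∀ i j, n < i → T.entry (i, j) = 0) ∧
      longestPitman n (rowPath T.entry) = longestPitman n (rowPath S.entry) by
    clear hT
    induction h with
    | refl => exact ⟨hS, hn, rfl⟩
    | tail _ hs ih =>
      obtain ⟨h1, h2, h3⟩ := ih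
      obtain ⟨h4, h5, h6⟩ := innerSlide_invariant hs h1 h2
      exact ⟨h4, h5, h6.trans h3⟩).2.2]
  refine (longestPitman_eq_self (fun i t => ?_) n).symm
  have hfin : {j | T.entry (i, j) ≠ 0 ∧ T.entry (i, j) ≤ t}.Finite :=
    (Set.finite_Iio (T.outer.rowLen i)).subset fun j hj =>
      YoungDiagram.mem_iff_lt_rowLen.1 ((T.entry_ne_zero_iff _).1 hj.1).1
  refine Nat.cast_le.2 (Set.ncard_le_ncard (fun j hj => ?_) hfin)
  have h1 := ((T.entry_ne_zero_iff _).1 hj.1).1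
  have h2 : (i, j) ∉ T.inner := by simp [hT]
  refine ⟨(T.entry_ne_zero_iff _).2 ⟨T.outer.up_left_mem (Nat.le_succ i) le_rfl h1, h2⟩, ?_⟩
  exact (T.col_strict i (i + 1) j (Nat.lt_succ_self i) h2 h1).le.trans hj.2

/-! ### Existence of rectifications -/

/-- The partition `μ` without its outer corner `c`. -/
def eraseCorner (μ : YoungDiagram) (c : ℕ × ℕ) (hc : IsOuterCorner μ c) : YoungDiagram where
  cells := μ.cells.erase c
  isLowerSet := by
    rintro ⟨i, j⟩ ⟨i', j'⟩ ⟨hi : i' ≤ i, hj : j' ≤ j⟩ h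
    simp only [Finset.coe_erase, Set.mem_sdiff, Finset.mem_coe, YoungDiagram.mem_cells,
      Set.mem_singleton_iff] at h ⊢
    refine ⟨μ.up_left_mem hi hj h.1, ?_⟩
    rintro rfl
    obtain ⟨-, h1, h2⟩ := hc
    rcases hi.eq_or_lt with rfl | hi
    · rcases hj.eq_or_lt with rfl | hj
      · exact h.2 rfl
      · exact h1 (μ.up_left_mem le_rfl hj h.1)
    · exact h2 (μ.up_left_mem hi hj h.1)

theorem mem_eraseCorner {μ : YoungDiagram} {c d : ℕ × ℕ} {hc : IsOuterCorner μ c} :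
    d ∈ eraseCorner μ c hc ↔ d ≠ c ∧ d ∈ μ := by
  rw [← YoungDiagram.mem_cells, ← YoungDiagram.mem_cells]
  exact Finset.mem_erase

theorem exists_isOuterCorner {μ : YoungDiagram} (h : μ ≠ ⊥) : ∃ c, IsOuterCorner μ c := by
  have hne : μ.cells.Nonempty := by
    rw [Finset.nonempty_iff_ne_empty]
    exact fun h0 => h (YoungDiagram.ext (by simpa using h0))
  obtain ⟨c, hc⟩ := μ.cells.exists_maximal hne
  refine ⟨c, (YoungDiagram.mem_cells c).1 hc.1, fun h1 => ?_, fun h1 => ?_⟩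
  · have := (hc.2 ((YoungDiagram.mem_cells _).2 h1) ⟨le_rfl, Nat.le_succ _⟩).2
    exact absurd this (by simp)
  · have := (hc.2 ((YoungDiagram.mem_cells _).2 h1) ⟨Nat.le_succ _, le_rfl⟩).1
    exact absurd this (by simp)

theorem exists_holeMoves {Y M : YoungDiagram} (N : ℕ) {f : ℕ × ℕ → ℕ} {h : ℕ × ℕ}
    (H : HoleTableau Y M f h) (hN : Y.rowLen 0 + Y.colLen 0 ≤ h.1 + h.2 + N) :
    ∃ f' e, Relation.ReflTransGen (HoleMove Y) (f, h) (f', e) ∧ HoleTableau Y M f' e ∧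
      IsOuterCorner Y e := by
  induction N generalizing f h with
  | zero =>
    have h1 := YoungDiagram.mem_iff_lt_rowLen.1 (Y.up_left_mem (Nat.zero_le h.1) le_rfl H.hole_mem)
    have h2 := YoungDiagram.mem_iff_lt_colLen.1 (Y.up_left_mem le_rfl (Nat.zero_le h.2) H.hole_mem)
    omega
  | succ N ih =>
    obtain ⟨i, j⟩ := h
    by_cases hr : (i, j + 1) ∈ Y ∧ ((i + 1, j) ∈ Y → f (i, j + 1) < f (i + 1, j))
    · obtain ⟨f', e, h1, h2⟩ := ih (H.move_right hr.1 hr.2) (by dsimp only at *; omega)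
      exact ⟨f', e, .head (.right f i j hr.1 hr.2) h1, h2⟩
    by_cases hd : (i + 1, j) ∈ Y ∧ ((i, j + 1) ∈ Y → f (i + 1, j) ≤ f (i, j + 1))
    · obtain ⟨f', e, h1, h2⟩ := ih (H.move_down hd.1 hd.2) (by dsimp only at *; omega)
      exact ⟨f', e, .head (.down f i j hd.1 hd.2) h1, h2⟩
    refine ⟨f, _, .refl, H, H.hole_mem, fun h1 => ?_, fun h1 => ?_⟩
    · refine hr ⟨h1, fun h2 => ?_⟩
      by_contra h3
      exact hd ⟨h2, fun _ => not_lt.1 h3⟩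
    · refine hd ⟨h1, fun h2 => ?_⟩
      by_contra h3
      exact hr ⟨h2, fun _ => not_le.1 h3⟩

theorem exists_innerSlide {S : SkewTableau} (hS : EntriesDistinct S.entry) (h : S.inner ≠ ⊥) :
    ∃ S', InnerSlide S S' ∧ EntriesDistinct S'.entry ∧
      S'.inner.cells.card < S.inner.cells.card := by
  obtain ⟨c, hc⟩ := exists_isOuterCorner h
  obtain ⟨f, e, hm, H, he⟩ := exists_holeMoves _
    (holeTableau hS hc (M := eraseCorner S.inner c hc) rfl) (Nat.le_add_left _ _)
  have nz (d : ℕ × ℕ) (h1 : d ∈ eraseCorner S.outer e he) (h2 : d ∉ eraseCorner S.inner c hc) :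
      f d ≠ 0 :=
    (H.ne_zero_iff d).2 ⟨(mem_eraseCorner.1 h1).2, h2, (mem_eraseCorner.1 h1).1⟩
  refine ⟨{ outer := eraseCorner S.outer e he
            inner := eraseCorner S.inner c hc
            inner_le := fun d hd => ?_
            entry := f
            pos := fun d h1 h2 => Nat.pos_of_ne_zero (nz d h1 h2)
            zero := fun d hd => ?_
            row_weak := fun i j₁ j₂ hj h1 h2 => ?_
            col_strict := fun i₁ i₂ j hi h1 h2 => ?_ },
    ⟨c, e, hc, he, hm, rfl, rfl⟩, H.distinct, Finset.card_erase_lt_of_mem hc.1⟩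
  · refine mem_eraseCorner.2 ⟨?_, S.inner_le (mem_eraseCorner.1 hd).2⟩
    rintro rfl
    exact H.hole_notMem hd
  · by_contra h0
    have h1 := (H.ne_zero_iff d).1 h0
    exact hd ⟨mem_eraseCorner.2 ⟨h1.2.2, h1.1⟩, h1.2.1⟩
  · have hle : (i, j₁) ≤ (i, j₂) := ⟨le_rfl, hj.le⟩
    exact H.le hle (nz _ ((eraseCorner S.outer e he).isLowerSet hle h2) h1)
      (nz _ h2 fun h3 => h1 ((eraseCorner S.inner c hc).isLowerSet hle h3))
  · have hle : (i₁, j) ≤ (i₂, j) := ⟨hi.le, le_rfl⟩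
    exact H.lt _ _ hle (by simp [hi.ne]) (nz _ ((eraseCorner S.outer e he).isLowerSet hle h2) h1)
      (nz _ h2 fun h3 => h1 ((eraseCorner S.inner c hc).isLowerSet hle h3))

theorem exists_isRectification {S : SkewTableau} (hS : EntriesDistinct S.entry) :
    ∃ T, IsRectification S T := by
  induction hk : S.inner.cells.card using Nat.strong_induction_on generalizing S with
  | _ k ih =>
    by_cases h : S.inner = ⊥
    · exact ⟨S, .refl, h⟩
    · obtain ⟨S', h1, h2, h3⟩ := exists_innerSlide hS h
      obtain ⟨T, h4, h5⟩ := ih _ (hk ▸ h3) h2 rfl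
      exact ⟨T, .head h1 h4, h5⟩

/-! ### Stabilization of the copies -/

theorem inRow_iff (S : SkewTableau) {x i : ℕ} (hx : 0 < x) :
    S.InRow x i ↔ rowPath S.entry i (x - 1) < rowPath S.entry i x := by
  have hfin (t : ℕ) : {j | S.entry (i, j) ≠ 0 ∧ S.entry (i, j) ≤ t}.Finite :=
    (Set.finite_Iio (S.outer.rowLen i)).subset fun j hj =>
      YoungDiagram.mem_iff_lt_rowLen.1 ((S.entry_ne_zero_iff _).1 hj.1).1
  constructor
  · rintro ⟨j, hj, rfl⟩
    refine Nat.cast_lt.2 (Set.ncard_lt_ncard ⟨fun l hl => ⟨hl.1, hl.2.trans (Nat.sub_le _ _)⟩,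
      fun h => ?_⟩ (hfin _))
    have h1 : S.entry (i, j) ≤ S.entry (i, j) - 1 := (h ⟨hx.ne', le_rfl⟩).2
    omega
  · intro h
    by_contra hne
    refine absurd h (not_lt.2 (Nat.cast_le.2 (Set.ncard_le_ncard (fun j hj => ⟨hj.1, ?_⟩)
      (hfin _))))
    have h1 : S.entry (i, j) ≠ x := fun h0 => by
      have h2 := (S.entry_ne_zero_iff _).1 hj.1
      exact hne ⟨j, by simpa [cells] using h2, h0⟩
    have h2 := hj.2
    omega

theorem copies_entry_ne_zero_iff {S : SkewTableau} {hS : S.IsStandard} {hdec : Antitone S.rowSize}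
    {k i j : ℕ} : (S.copies hS hdec k).entry (i, j) ≠ 0 ↔
      S.inner.rowLen i ≤ j ∧ j < S.inner.rowLen i + k * S.rowSize i := by
  rw [entry_ne_zero_iff, and_comm]
  simp only [copies]
  rw [mem_copiesOuter, YoungDiagram.mem_iff_lt_rowLen, not_lt]

theorem copies_entriesDistinct (S : SkewTableau) (hS : S.IsStandard) (hdec : Antitone S.rowSize)
    (k : ℕ) : EntriesDistinct (S.copies hS hdec k).entry := by
  rintro ⟨i, j⟩ ⟨i', j'⟩ h1 h2
  have h3 := copies_entry_ne_zero_iff.1 h1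
  have h4 := copies_entry_ne_zero_iff.1 (h2 ▸ h1)
  simp only [copies] at h2
  obtain ⟨q, u, e, m, v, l⟩ := copies_aux h3.1 h3.2
  obtain ⟨q', u', e', m', v', l'⟩ := copies_aux h4.1 h4.2
  rw [v, v'] at h2
  have b := hS.mapsTo m
  have b' := hS.mapsTo m'
  simp only [Set.mem_Icc] at b b'
  have hq : q = q' := by
    rcases lt_trichotomy q q' with hq | hq | hq
    · have := Nat.mul_le_mul_left S.size (show q + 1 ≤ q' from hq)
      rw [Nat.mul_add] at this
      omega
    · exact hq
    · have := Nat.mul_le_mul_left S.size (show q' + 1 ≤ q from hq)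
      rw [Nat.mul_add] at this
      omega
  subst hq
  have h5 := hS.injOn m m' (by omega)
  simp only [Prod.mk.injEq] at h5 ⊢
  obtain ⟨rfl, h5⟩ := h5
  exact ⟨rfl, by omega⟩

/-- After one period, row `i` of the copies has gained as many entries as `S` has in row `i`. -/
theorem rowPath_copies_add (S : SkewTableau) (hS : S.IsStandard) (hdec : Antitone S.rowSize)
    {k i t : ℕ} (ht : t + S.size ≤ k * S.size) :
    rowPath (S.copies hS hdec k).entry i (t + S.size) =
      rowPath (S.copies hS hdec k).entry i t + S.rowSize i := by
  set a := S.inner.rowLen i with ha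
  set r := S.rowSize i with hr
  set E : ℕ → ℕ := fun j => S.copiesEntry k (i, j) with hE
  have nz (j : ℕ) : E j ≠ 0 ↔ a ≤ j ∧ j < a + k * r :=
    copies_entry_ne_zero_iff (hS := hS) (hdec := hdec)
  have hle (u : ℕ) (hu : u < r) : 1 ≤ S.entry (i, a + u) ∧ S.entry (i, a + u) ≤ S.size := by
    have h1 := S.inner_add_rowSize i
    have := hS.mapsTo (show (i, a + u) ∈ (S.cells : Set (ℕ × ℕ)) from
      mem_cells.2 ⟨by omega, by omega⟩)
    simpa using this
  have hval (u q : ℕ) (hu : u < r) (hq : q < k) :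
      E (a + u + q * r) = S.entry (i, a + u) + S.size * q := by
    have h1 := Nat.mul_le_mul_right r (show q + 1 ≤ k from hq)
    rw [Nat.add_mul] at h1
    simp only [hE, copiesEntry, ← ha, ← hr]
    rw [if_pos ⟨by omega, by omega⟩, show a + u + q * r - a = u + q * r by omega,
      Nat.add_mul_mod_self_right, Nat.add_mul_div_right _ _ (by omega), Nat.mod_eq_of_lt hu,
      Nat.div_eq_of_lt hu, Nat.zero_add]
  have hdecomp (j : ℕ) (hj : a ≤ j ∧ j < a + k * r) :
      ∃ u q, u < r ∧ q < k ∧ j = a + u + q * r := by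
    have hr0 : 0 < r := by
      rcases Nat.eq_zero_or_pos r with h | h
      · rw [h] at hj
        omega
      · exact h
    refine ⟨(j - a) % r, (j - a) / r, Nat.mod_lt _ hr0, Nat.div_lt_of_lt_mul ?_, ?_⟩
    · rw [Nat.mul_comm]
      omega
    · have := Nat.mod_add_div (j - a) r
      rw [Nat.mul_comm] at this
      omega
  have hset : {j | E j ≠ 0 ∧ E j ≤ t + S.size} =
      Set.Ico a (a + r) ∪ (fun j => j + r) '' {j | E j ≠ 0 ∧ E j ≤ t} := by
    ext j
    simp only [Set.mem_ofPred_eq, Set.mem_union, Set.mem_Ico, Set.mem_image]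
    constructor
    · rintro ⟨h1, h2⟩
      obtain ⟨u, q, hu, hq, rfl⟩ := hdecomp j ((nz j).1 h1)
      cases q with
      | zero => exact Or.inl (by omega)
      | succ q =>
        rw [hval u _ hu hq, Nat.mul_add] at h2
        have h3 := hval u q hu (by omega)
        have h4 := hle u hu
        exact Or.inr ⟨a + u + q * r, ⟨by omega, by omega⟩, by ring⟩
    · rintro (⟨h1, h2⟩ | ⟨j, ⟨h1, h2⟩, rfl⟩)
      · obtain ⟨u, rfl⟩ := Nat.exists_eq_add_of_le h1
        have hk : 0 < k := by
          rcases Nat.eq_zero_or_pos k with rfl | h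
          · have := hle u (by omega)
            omega
          · exact h
        have h3 := hval u 0 (by omega) hk
        have h4 := hle u (by omega)
        rw [Nat.zero_mul, Nat.mul_zero, Nat.add_zero, Nat.add_zero] at h3
        omega
      · obtain ⟨u, q, hu, hq, rfl⟩ := hdecomp j ((nz j).1 h1)
        have h4 := hle u hu
        rw [hval u q hu hq] at h2
        -- The last copy has no entry up to `t`, so it is not the copy of `j`.
        have hq1 : q + 1 < k := by
          by_contra hq1
          obtain rfl : k = q + 1 := by omega
          rw [Nat.add_mul, Nat.mul_comm q] at ht
          omega
        have h3 := hval u (q + 1) hu hq1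
        rw [Nat.mul_add] at h3
        rw [show a + u + q * r + r = a + u + (q + 1) * r by ring]
        omega
  have hfin : {j | E j ≠ 0 ∧ E j ≤ t}.Finite :=
    (Set.finite_Iio (a + k * r)).subset fun j hj => ((nz j).1 hj.1).2
  change (({j | E j ≠ 0 ∧ E j ≤ t + S.size} : Set ℕ).ncard : ℤ) =
    ({j | E j ≠ 0 ∧ E j ≤ t} : Set ℕ).ncard + r
  rw [hset, Set.ncard_union_eq ?_ (Set.finite_Ico _ _) (hfin.image _),
    Set.ncard_image_of_injective _ (add_left_injective r), ← Finset.coe_Ico, Set.ncard_coe_finset,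
    Nat.card_Ico]
  · push_cast
    rw [Nat.add_sub_cancel_left]
    ring
  · rw [Set.disjoint_left]
    rintro _ ⟨h1, h2⟩ ⟨j, ⟨h3, -⟩, rfl⟩
    have := (nz j).1 h3
    dsimp only at h2
    omega

end SkewTableau

open SkewTableau in
theorem mainTheorem4 (S : SkewTableau) (hS : S.IsStandard) (hdec : Antitone S.rowSize)
    (b : ℕ) (hb : 2 ≤ b) (hrows : ∀ i, b ≤ i → S.rowSize i = 0) :
    S.StabilizesAt hS hdec (2 * b - 2) := by
  obtain ⟨n, rfl⟩ := Nat.exists_eq_add_of_le' hb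
  set k := 2 * (n + 2) - 2 with hk
  have hdist := S.copies_entriesDistinct hS hdec k
  refine ⟨by omega, exists_isRectification hdist, fun T hT x hx1 hx2 i => ?_⟩
  have hzero (i j : ℕ) (hi : n + 1 < i) : (S.copies hS hdec k).entry (i, j) = 0 := by
    by_contra h
    have h1 := copies_entry_ne_zero_iff.1 h
    rw [hrows i (by omega)] at h1
    omega
  have hpath := rowPath_rectification hT hdist hzero
  have hm : 0 < S.size := by
    rcases Nat.eq_zero_or_pos S.size with h | h
    · rw [h] at hx1 hx2
      omega
    · exact h
  set p := rowPath (S.copies hS hdec k).entry with hp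
  have hsettled : Settled S.size (k * S.size) p (longestPitman (n + 1) p) (k - 1) i := by
    by_cases hi : i ≤ n + 1
    · refine (Settled.longestPitman (A := 0) hm (fun j t ht => ?_) ⟨0, by simp⟩
        (fun j _ => ⟨0, by simp⟩) i hi).mono (by omega)
      have h1 := S.rowPath_copies_add hS hdec (i := j) ht
      have h2 := S.rowPath_copies_add hS hdec (i := j + 1) ht
      have h3 := hdec (Nat.le_succ j)
      rw [← hp] at h1 h2
      simp only [Nat.succ_eq_add_one] at h3
      omega
    · exact ⟨0, by simp [longestPitman_of_lt (show n + 1 < i by omega)]⟩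
  obtain ⟨c, hc⟩ := hsettled
  rw [inRow_iff T (by omega), inRow_iff _ (by omega), hpath, hc x (by omega) hx2,
    hc (x - 1) (by omega) (by omega), add_lt_add_iff_right]
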